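/- Let $(\mathcal S,\mathcal A,H,\alpha,P,r)$ be a finite episodic Markov decision process: finite state set $\mathcal S$, finite nonempty action set $\mathcal A$, episode length $H$, initial distribution $\alpha$, transition probabilities $P_h(y\mid x,a)$ and deterministic rewards $r_h(x,a)\in[0,1]$ for $h=1,\dots,H$. A policy is a family $\pi=(\pi_h)_{h=1}^H$ of maps $\mathcal S\to\mathcal A$; $V_1^\pi(x)$ is the expected total reward of an episode started in $x$ under $\pi$, and $V_1^*(x)=\max_\pi V_1^\pi(x)$. A learner interacts with the process for $K$ episodes; write $T=KH$. In episode $t$ it follows a policy $\pi_t$ chosen from the information available before that episode; the initial state $x_{1,t}$ has law $\alpha$ given that information, and, given everything observed up to stage $h$, the next state $x_{h+1,t}$ has law $P_h(\cdot\mid x_{h,t},\pi_{t,h}(x_{h,t}))$. The regret is $\mathrm{Reg}_T=\sum_{t=1}^K\bigl(V_1^*(x_{1,t})-V_1^{\pi_t}(x_{1,t})\bigr)$. Before episode $t$ the learner fixes, as (measurable) functions of the information available then, a real-valued reference function $\widehat P_{h,t}(y\mid x,a)$ (for instance the empirical transition frequencies), aggregation functions $w_{h,i,t}:\mathcal S\to\mathbb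 R$ and widths $b_{h,i,t}:\mathcal S\times\mathcal A\to\mathbb R$, where $i$ ranges over a finite set $\mathcal I$. Let $\mathcal P_t$ be the set of transition functions $p$ such that $\sum_y w_{h,i,t}(y)\,|p_h(y\mid x,a)-\widehat P_{h,t}(y\mid x,a)|\le b_{h,i,t}(x,a)$ for all $h,i,x,a$. Consider the optimistic linear program: maximize $\sum_{h,x,a,y}q_h(x,a,y)\,r_h(x,a)$ over $q,\varepsilon\ge0$ such that $q$ satisfies the initial and flow constraints of an occupancy measure, $|q_h(x,a,y)-\widehat P_{h,t}(y\mid x,a)\sum_z q_h(x,a,z)|\le\varepsilon_h(x,a,y)$ and $\sum_y w_{h,i,t}(y)\varepsilon_h(x,a,y)\le b_{h,i,t}(x,a)\sum_z q_h(x,a,z)$. The constraints of its dual at $(h,x,a)$ are $$\beta_h(x)\ \ge\ r_h(x,a)+\beta_{h+1}(y)+\sum_z\widehat P_{h,t}(z\mid x,a)\bigl(\mu^+(z)-\mu^-(z)\bigr)-\bigl(\mu^+(y)-\mu^-(y)\bigr)+\sum_i b_{h,i,t}(x,a)\mu_i\quad(y\in\mathcal S),$$ with multipliers $\mu^+,\mu^-,\mu\ge0$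 (depending on $h,x,a$) subject to $\mu^+(y)+\mu^-(y)\le\sum_i w_{h,i,t}(y)\mu_i$ for all $y$, and $\beta_{H+1}=0$. Eliminating the multipliers turns them into $\beta_h(x)\ge r_h(x,a)+\mathrm{CB}_{h,t}(x,a)+\sum_y\widehat P_{h,t}(y\mid x,a)\beta_{h+1}(y)$, where the exploration bonus $\mathrm{CB}_{h,t}(x,a)$ is the least $z\in\mathbb R$ such that, for some admissible multipliers, the constraints above hold with $r_h(x,a)+z+\sum_y\widehat P_{h,t}(y\mid x,a)\beta_{h+1}(y)$ in place of $\beta_h(x)$. Let $\beta^*_t$ be the solution computed by dynamic programming, $\beta^*_{H+1,t}=0$ and $$\beta^*_{h,t}(x)=\max_{a\in\mathcal A}\Bigl\{r_h(x,a)+\mathrm{CB}_{h,t}(x,a)+\sum_y\widehat P_{h,t}(y\mid x,a)\,\beta^*_{h+1,t}(y)\Bigr\},$$ with $\mathrm{CB}_{h,t}$ formed from $\beta_{h+1}=\beta^*_{h+1,t}$. Whenever $\mathcal P_t\ne\emptyset$, the policy $\pi_t$ attains this maximum at every $h$ and $x$. Put $\mathrm{CP}_{h,t}(x,a)=\sum_y\bigl(\widehat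 P_{h,t}(y\mid x,a)-P_h(y\mid x,a)\bigr)\beta^*_{h+1,t}(y)$. Then for every $\delta\in(0,1]$ there is an event $G$ of probability at least $1-2\delta$ such that on $G\cap\bigcap_{t=1}^K\{P\in\mathcal P_t\}$ $$\mathrm{Reg}_T\ \le\ \sum_{t=1}^K\sum_{h=1}^H\mathrm{CB}_{h,t}\bigl(x_{h,t},\pi_{t,h}(x_{h,t})\bigr)+\sum_{t=1}^K\sum_{h=1}^H\mathrm{CP}_{h,t}\bigl(x_{h,t},\pi_{t,h}(x_{h,t})\bigr)+2H\sqrt{2T\log(1/\delta)} .$$ -/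

import Mathlib

open MeasureTheory

noncomputable section

/-- A finite episodic Markov decision process with episode length `H`. Stages are indexed from `0`:
the index `h : Fin H` is the stage called `h + 1` in `1, …, H`. -/
structure EpisodicMDP (S A : Type*) [Fintype S] (H : ℕ) where
  /-- distribution of the initial state -/
  initial : S → ℝ
  initial_mem : initial ∈ stdSimplex ℝ S
  /-- `trans h x a y` is the probability `P_h(y | x, a)` -/
  trans : Fin H → S → A → S → ℝ
  trans_mem : ∀ h x a, trans h x a ∈ stdSimplex ℝ S
  /-- deterministic reward `r_h(x, a)` -/
  reward : Fin H → S → A → ℝ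
  reward_mem : ∀ h x a, reward h x a ∈ Set.Icc (0 : ℝ) 1

/-- The parameters of the optimistic linear program of one episode: the reference transition
function `P̂`, the constraint-aggregation functions `w` and the confidence widths `b`. No sign or
normalization is imposed; in particular the empirical frequencies, whose rows vanish at pairs that
were never visited, are allowed as `ref`. -/
structure ConfidenceData (S A I : Type*) (H : ℕ) where
  ref : Fin H → S → A → S → ℝ
  weight : Fin H → I → S → ℝ
  width : Fin H → I → S → A → ℝ

namespace EpisodicMDP

variable {S A : Type*} [Fintype S] {H : ℕ}

open Classical in
/-- The value `V_1^π(x)`: the expectation of the total reward of one episode under the policy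
`π = (π_h)_h` when the initial state is `x`, as a sum over all state trajectories that start
in `x` (the last coordinate of a trajectory is the state reached after the last stage). -/
def value (M : EpisodicMDP S A H) (π : Fin H → S → A) (x : S) : ℝ :=
  ∑ τ : Fin (H + 1) → S with τ 0 = x,
    (∏ h : Fin H, M.trans h (τ h.castSucc) (π h (τ h.castSucc)) (τ h.succ)) *
      ∑ h : Fin H, M.reward h (τ h.castSucc) (π h (τ h.castSucc))

/-- The optimal value `V_1^*(x) = max_π V_1^π(x)`; the set of policies is finite. -/
def optValue (M : EpisodicMDP S A H) (x : S) : ℝ :=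
  ⨆ π : Fin H → S → A, M.value π x

end EpisodicMDP

namespace ConfidenceData

variable {S A I : Type*} [Fintype S] [Fintype I] {H : ℕ}

/-- The confidence set: all transition functions `p` with
`∑_y w_{h,i}(y) |p_h(y|x,a) - P̂_h(y|x,a)| ≤ b_{h,i}(x,a)` for all `h, i, x, a`. -/
def confidenceSet (D : ConfidenceData S A I H) : Set (Fin H → S → A → S → ℝ) :=
  {p | (∀ h x a, p h x a ∈ stdSimplex ℝ S) ∧
    ∀ h i x a, ∑ y, D.weight h i y * |p h x a y - D.ref h x a y| ≤ D.width h i x a}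

/-- The constraints of the dual of the optimistic linear program

  maximize `∑ q_h(x,a,y) r_h(x,a)` over flows `q ≥ 0` and slacks `ε ≥ 0` subject to
  `|q_h(x,a,y) - P̂_h(y|x,a) ∑_z q_h(x,a,z)| ≤ ε_h(x,a,y)` and
  `∑_y w_{h,i}(y) ε_h(x,a,y) ≤ b_{h,i}(x,a) ∑_z q_h(x,a,z)`

that involve the pair `(x, a)` at stage `h`. Here `v` stands for `β_h(x)`, `β'` for `β_{h+1}`, and
`μp, μm, μ` are the multipliers of the two halves of the first and of the second constraint. -/
def DualConstraint (M : EpisodicMDP S A H) (D : ConfidenceData S A I H) (h : Fin H) (x : S) (a : A)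
    (v : ℝ) (β' : S → ℝ) (μp μm : S → ℝ) (μ : I → ℝ) : Prop :=
  (∀ y, 0 ≤ μp y) ∧ (∀ y, 0 ≤ μm y) ∧ (∀ i, 0 ≤ μ i) ∧
  (∀ y, μp y + μm y ≤ ∑ i, D.weight h i y * μ i) ∧
  ∀ y, M.reward h x a ≤ v - β' y - ∑ z, D.ref h x a z * (μp z - μm z) + (μp y - μm y)
    - ∑ i, D.width h i x a * μ i

/-- The exploration bonus `CB_h(x,a)` for the next-stage values `β' = β_{h+1}`: the least `z` such
that `β_h(x) = r_h(x,a) + z + ∑_y P̂_h(y|x,a) β_{h+1}(y)` meets the dual constraints at `(h,x,a)`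
for some choice of the multipliers. Thus, after elimination of the multipliers, the dual constraints
read `β_h(x) ≥ r_h(x,a) + CB_h(x,a) + ∑_y P̂_h(y|x,a) β_{h+1}(y)`. -/
def bonusOf (M : EpisodicMDP S A H) (D : ConfidenceData S A I H) (h : Fin H) (x : S) (a : A)
    (β' : S → ℝ) : ℝ :=
  sInf {z | ∃ (μp μm : S → ℝ) (μ : I → ℝ),
    D.DualConstraint M h x a (M.reward h x a + z + ∑ y, D.ref h x a y * β' y) β' μp μm μ}

/-- The optimistic value function `β^*` computed by dynamic programming: `β^*_{H+1} = 0` and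
`β^*_h(x) = max_a (r_h(x,a) + CB_h(x,a) + ∑_y P̂_h(y|x,a) β^*_{h+1}(y))`.
The index `h.castSucc` is stage `h`, the index `h.succ` the stage after it. -/
def optimisticValue [Fintype A] [Nonempty A] (M : EpisodicMDP S A H) (D : ConfidenceData S A I H) :
    Fin (H + 1) → S → ℝ :=
  Fin.reverseInduction (motive := fun _ => S → ℝ) (fun _ => 0) fun h β' x =>
    Finset.univ.sup' Finset.univ_nonempty fun a =>
      M.reward h x a + D.bonusOf M h x a β' + ∑ y, D.ref h x a y * β' y

/-- The exploration bonus `CB_h(x,a)`. -/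
def bonus [Fintype A] [Nonempty A] (M : EpisodicMDP S A H) (D : ConfidenceData S A I H)
    (h : Fin H) (x : S) (a : A) : ℝ :=
  D.bonusOf M h x a (D.optimisticValue M h.succ)

/-- `CP_h(x,a) = ∑_y (P̂_h(y|x,a) - P_h(y|x,a)) β^*_{h+1}(y)`. -/
def transitionGap [Fintype A] [Nonempty A] (M : EpisodicMDP S A H) (D : ConfidenceData S A I H)
    (h : Fin H) (x : S) (a : A) : ℝ :=
  ∑ y, (D.ref h x a y - M.trans h x a y) * D.optimisticValue M h.succ y

/-- The policy attains the maximum in the dynamic program at every stage and state. -/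
def IsOptimisticPolicy [Fintype A] [Nonempty A] (M : EpisodicMDP S A H)
    (D : ConfidenceData S A I H) (π : Fin H → S → A) : Prop :=
  ∀ h x, D.optimisticValue M h.castSucc x =
    M.reward h x (π h x) + D.bonus M h x (π h x) +
      ∑ y, D.ref h x (π h x) y * D.optimisticValue M h.succ y

end ConfidenceData

/-- Interaction of a learner with the MDP for `K` episodes. `x t h` is the state at stage `h` of
episode `t`, and `π t` is the policy followed in episode `t`. The σ-algebra `𝓕 (t * (H + 1))` is the
information available before episode `t`, and `𝓕 (t * (H + 1) + h + 1)` the information available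
once `x t h` has been observed; besides the past states it may contain independent randomization of
the learner. -/
structure IsEpisodicInteraction {S A Ω : Type*} [Fintype S] {H K : ℕ} {mΩ : MeasurableSpace Ω}
    (M : EpisodicMDP S A H) (μ : Measure Ω) (𝓕 : Filtration ℕ mΩ)
    (x : Fin K → Fin (H + 1) → Ω → S) (π : Fin K → Ω → Fin H → S → A) : Prop where
  measurable_state : ∀ (t : Fin K) (h : Fin (H + 1)) (y : S),
    MeasurableSet[𝓕 ((t : ℕ) * (H + 1) + (h : ℕ) + 1)] (x t h ⁻¹' {y})
  measurable_policy : ∀ (t : Fin K) (h : Fin H) (y : S) (a : A),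
    MeasurableSet[𝓕 ((t : ℕ) * (H + 1))] {ω | π t ω h y = a}
  initial_law : ∀ (t : Fin K) (y : S),
    μ[(x t 0 ⁻¹' {y}).indicator (fun _ => (1 : ℝ)) | 𝓕 ((t : ℕ) * (H + 1))]
      =ᵐ[μ] fun _ => M.initial y
  transition_law : ∀ (t : Fin K) (h : Fin H) (y : S),
    μ[(x t h.succ ⁻¹' {y}).indicator (fun _ => (1 : ℝ)) | 𝓕 ((t : ℕ) * (H + 1) + (h : ℕ) + 1)]
      =ᵐ[μ] fun ω => M.trans h (x t h.castSucc ω) (π t ω h (x t h.castSucc ω)) y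

/-- The parameters used in episode `t` are determined by the information available before it. -/
structure IsPredictableConfidence {S A I Ω : Type*} {H K : ℕ} {mΩ : MeasurableSpace Ω}
    (𝓕 : Filtration ℕ mΩ) (D : Fin K → Ω → ConfidenceData S A I H) : Prop where
  measurable_ref : ∀ (t : Fin K) (h : Fin H) (x : S) (a : A) (y : S),
    Measurable[𝓕 ((t : ℕ) * (H + 1))] fun ω => (D t ω).ref h x a y
  measurable_weight : ∀ (t : Fin K) (h : Fin H) (i : I) (y : S),
    Measurable[𝓕 ((t : ℕ) * (H + 1))] fun ω => (D t ω).weight h i y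
  measurable_width : ∀ (t : Fin K) (h : Fin H) (i : I) (x : S) (a : A),
    Measurable[𝓕 ((t : ℕ) * (H + 1))] fun ω => (D t ω).width h i x a

/-- The regret `∑_t (V_1^*(x_{1,t}) - V_1^{π_t}(x_{1,t}))`. -/
def regret {S A Ω : Type*} [Fintype S] {H K : ℕ} (M : EpisodicMDP S A H)
    (x : Fin K → Fin (H + 1) → Ω → S) (π : Fin K → Ω → Fin H → S → A) (ω : Ω) : ℝ :=
  ∑ t, (M.optValue (x t 0 ω) - M.value (π t ω) (x t 0 ω))

end

/-!
The multipliers of the dual program certify, by weak duality, that adding the bonus to the expected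
next value under the reference function dominates the expected next value under every transition
function in the confidence set. Hence, when that set contains the true transitions, the optimistic
value lies between `V^*` and the number of remaining stages, and the regret is at most the sum of
its excesses over `V^{π_t}`. Along the observed trajectory each excess telescopes into bonuses,
transition gaps and conditionally centred differences. Clamping the excess to `[0, H]` bounds those
differences by `H` on the whole sample space, so that Azuma–Hoeffding controls their sum.
-/

noncomputable section

/-! ### Backward recursion for the value of a policy -/

section TrajectoryExpectation

variable {S R : Type*} [Fintype S] [CommSemiring R] {n : ℕ}

open Classical in
/-- The expectation of a function `F` of the trajectory of an inhomogeneous Markov chain with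
transition kernels `p 0, …, p (n - 1)` started in `x`, written as a sum over trajectories. The rows
of `p` need not sum to one. -/
def trajectoryExpectation (p : Fin n → S → S → R) (F : (Fin (n + 1) → S) → R) (x : S) : R :=
  ∑ τ : Fin (n + 1) → S with τ 0 = x, (∏ h, p h (τ h.castSucc) (τ h.succ)) * F τ

open Classical in
theorem sum_filter_apply_zero_eq_sum_cons (f : (Fin (n + 1) → S) → R) (x : S) :
    ∑ τ : Fin (n + 1) → S with τ 0 = x, f τ = ∑ σ : Fin n → S, f (Fin.cons x σ) := by
  refine Finset.sum_bij' (fun τ _ => Fin.tail τ) (fun σ _ => Fin.cons x σ) (by simp) (by simp)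
    ?_ (by simp) ?_
  all_goals
    intro τ hτ
    obtain rfl := (Finset.mem_filter.1 hτ).2
    simp

theorem trajectoryExpectation_zero (p : Fin 0 → S → S → R) (F : (Fin 1 → S) → R) (x : S) :
    trajectoryExpectation p F x = F fun _ => x := by
  rw [trajectoryExpectation, sum_filter_apply_zero_eq_sum_cons, Fintype.sum_unique,
    Finset.prod_of_isEmpty, one_mul]
  exact congrArg F (funext fun h => by rw [Fin.fin_one_eq_zero h, Fin.cons_zero])

theorem trajectoryExpectation_succ (p : Fin (n + 1) → S → S → R) (F : (Fin (n + 2) → S) → R)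
    (x : S) :
    trajectoryExpectation p F x =
      ∑ y, p 0 x y * trajectoryExpectation (Fin.tail p) (fun σ => F (Fin.cons x σ)) y := by
  classical
  simp only [trajectoryExpectation, sum_filter_apply_zero_eq_sum_cons _ x]
  rw [← Finset.sum_fiberwise _ fun σ : Fin (n + 1) → S => σ 0]
  refine Finset.sum_congr rfl fun y _ => ?_
  rw [Finset.mul_sum]
  refine Finset.sum_congr (by congr) fun σ hσ => ?_
  obtain rfl := (Finset.mem_filter.1 hσ).2
  rw [Fin.prod_univ_succ]
  simp [Fin.tail, mul_assoc]

theorem trajectoryExpectation_add (p : Fin n → S → S → R) (F G : (Fin (n + 1) → S) → R) (x : S) :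
    trajectoryExpectation p (fun τ => F τ + G τ) x =
      trajectoryExpectation p F x + trajectoryExpectation p G x := by
  simp only [trajectoryExpectation, mul_add, Finset.sum_add_distrib]

theorem trajectoryExpectation_const {p : Fin n → S → S → R} (hp : ∀ h x, ∑ y, p h x y = 1)
    (c : R) (x : S) : trajectoryExpectation p (fun _ => c) x = c := by
  induction n generalizing x with
  | zero => rw [trajectoryExpectation_zero]
  | succ n ih =>
    simp_rw [trajectoryExpectation_succ, ih (p := Fin.tail p) fun h => hp h.succ]
    rw [← Finset.sum_mul, hp, one_mul]

theorem trajectoryExpectation_sum_eq_of_recursion {p : Fin n → S → S → R}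
    (hp : ∀ h x, ∑ y, p h x y = 1) {r : Fin n → S → R} {V : Fin (n + 1) → S → R}
    (hlast : ∀ x, V (Fin.last n) x = 0)
    (hV : ∀ h x, V h.castSucc x = r h x + ∑ y, p h x y * V h.succ y) (x : S) :
    trajectoryExpectation p (fun τ => ∑ h, r h (τ h.castSucc)) x = V 0 x := by
  induction n generalizing x with
  | zero => simpa [trajectoryExpectation_zero] using (hlast x).symm
  | succ n ih =>
    have htail (y : S) : trajectoryExpectation (Fin.tail p)
        (fun σ => ∑ h : Fin n, r h.succ (σ h.castSucc)) y = V (Fin.succ 0) y :=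
      ih (fun h => hp h.succ) (V := Fin.tail V) (fun y => hlast y) (fun h y => hV h.succ y) y
    have hfirst (σ : Fin (n + 1) → S) :
        ∑ h, r h ((Fin.cons x σ : Fin (n + 2) → S) h.castSucc) =
          r 0 x + ∑ h : Fin n, r h.succ (σ h.castSucc) := by
      simp [Fin.sum_univ_succ]
    simp_rw [trajectoryExpectation_succ, hfirst, trajectoryExpectation_add,
      trajectoryExpectation_const (p := Fin.tail p) fun h => hp h.succ, htail, mul_add,
      Finset.sum_add_distrib, ← Finset.sum_mul, hp, one_mul]
    exact (hV 0 x).symm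

end TrajectoryExpectation

namespace EpisodicMDP

variable {S A : Type*} [Fintype S] {H : ℕ}

/-- The value `V_h^π(x)` of the policy `π` from stage `h` on, by backward recursion. -/
def stageValue (M : EpisodicMDP S A H) (π : Fin H → S → A) : Fin (H + 1) → S → ℝ :=
  Fin.reverseInduction (motive := fun _ => S → ℝ) (fun _ => 0) fun h V x =>
    M.reward h x (π h x) + ∑ y, M.trans h x (π h x) y * V y

theorem stageValue_last (M : EpisodicMDP S A H) (π : Fin H → S → A) (x : S) :
    M.stageValue π (Fin.last H) x = 0 := by
  simp [stageValue]

theorem stageValue_castSucc (M : EpisodicMDP S A H) (π : Fin H → S → A) (h : Fin H) (x : S) :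
    M.stageValue π h.castSucc x =
      M.reward h x (π h x) + ∑ y, M.trans h x (π h x) y * M.stageValue π h.succ y := by
  simp [stageValue]

theorem value_eq_stageValue_zero (M : EpisodicMDP S A H) (π : Fin H → S → A) (x : S) :
    M.value π x = M.stageValue π 0 x :=
  trajectoryExpectation_sum_eq_of_recursion (p := fun h x => M.trans h x (π h x))
    (fun h x => (M.trans_mem h x (π h x)).2) (M.stageValue_last π) (M.stageValue_castSucc π) x

theorem stageValue_nonneg (M : EpisodicMDP S A H) (π : Fin H → S → A) (h : Fin (H + 1)) (x : S) :
    0 ≤ M.stageValue π h x := by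
  induction h using Fin.reverseInduction generalizing x with
  | last => rw [stageValue_last]
  | cast h ih =>
    rw [stageValue_castSucc]
    exact add_nonneg (M.reward_mem _ _ _).1
      (Finset.sum_nonneg fun y _ => mul_nonneg ((M.trans_mem _ _ _).1 y) (ih y))

end EpisodicMDP

/-! ### Optimism by weak duality -/

namespace ConfidenceData

variable {S A I : Type*} [Fintype S] [Fintype I] {H : ℕ} {M : EpisodicMDP S A H}
  {D : ConfidenceData S A I H} {p : Fin H → S → A → S → ℝ}

theorem sum_sub_ref_mul_le (hp : p ∈ D.confidenceSet) (h : Fin H) (x : S) (a : A)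
    {f : S → ℝ} {μ : I → ℝ} (hμ : ∀ i, 0 ≤ μ i) (hf : ∀ y, |f y| ≤ ∑ i, D.weight h i y * μ i) :
    ∑ y, (p h x a y - D.ref h x a y) * f y ≤ ∑ i, D.width h i x a * μ i :=
  calc ∑ y, (p h x a y - D.ref h x a y) * f y
      ≤ ∑ y, |p h x a y - D.ref h x a y| * |f y| :=
        Finset.sum_le_sum fun y _ => (le_abs_self _).trans_eq (abs_mul _ _)
    _ ≤ ∑ y, |p h x a y - D.ref h x a y| * ∑ i, D.weight h i y * μ i := by
        gcongr with y
        exact hf y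
    _ = ∑ i, (∑ y, D.weight h i y * |p h x a y - D.ref h x a y|) * μ i := by
        simp_rw [Finset.mul_sum, Finset.sum_mul]
        rw [Finset.sum_comm]
        exact Finset.sum_congr rfl fun i _ => Finset.sum_congr rfl fun y _ => by ring
    _ ≤ ∑ i, D.width h i x a * μ i := by
        gcongr with i
        · exact hμ i
        · exact hp.2 h i x a

theorem reward_add_sum_mul_le_of_dualConstraint (hp : p ∈ D.confidenceSet) {h : Fin H} {x : S}
    {a : A} {v : ℝ} {β' μp μm : S → ℝ} {μ : I → ℝ}
    (hdual : D.DualConstraint M h x a v β' μp μm μ) :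
    M.reward h x a + ∑ y, p h x a y * β' y ≤ v := by
  obtain ⟨hμp, hμm, hμ, hweight, hv⟩ := hdual
  obtain ⟨hp0, hp1⟩ := hp.1 h x a
  have hgap := sum_sub_ref_mul_le hp h x a (f := fun y => μp y - μm y) hμ fun y =>
    (abs_le.2 ⟨by linarith [hμp y], by linarith [hμm y]⟩).trans (hweight y)
  have haverage : ∑ y, p h x a y * (M.reward h x a + β' y - (μp y - μm y)) ≤
      ∑ y, p h x a y * (v - ∑ z, D.ref h x a z * (μp z - μm z) - ∑ i, D.width h i x a * μ i) :=
    Finset.sum_le_sum fun y _ => mul_le_mul_of_nonneg_left (by linarith [hv y]) (hp0 y)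
  simp only [← Finset.sum_mul, hp1, one_mul, mul_sub (p h x a _), mul_add, sub_mul,
    Finset.sum_sub_distrib, Finset.sum_add_distrib] at haverage hgap
  simp only [mul_sub, Finset.sum_sub_distrib] at haverage hgap
  linarith

theorem dualConstraint_zero (M : EpisodicMDP S A H) (D : ConfidenceData S A I H) (h : Fin H)
    (x : S) (a : A) {β' : S → ℝ} {B : ℝ} (hB : ∀ y, β' y ≤ B) :
    D.DualConstraint M h x a (M.reward h x a + B) β' 0 0 0 := by
  simpa [DualConstraint, add_sub_assoc] using hB

theorem sum_mul_le_bonusOf_add (hp : p ∈ D.confidenceSet) (h : Fin H) (x : S) (a : A)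
    (β' : S → ℝ) :
    ∑ y, p h x a y * β' y ≤ D.bonusOf M h x a β' + ∑ y, D.ref h x a y * β' y := by
  obtain ⟨B, hB⟩ := (Set.finite_range β').bddAbove
  rw [← sub_le_iff_le_add]
  refine le_csInf ⟨B - ∑ y, D.ref h x a y * β' y, 0, 0, 0, ?_⟩ ?_
  · rw [add_assoc, sub_add_cancel]
    exact dualConstraint_zero M D h x a fun y => hB ⟨y, rfl⟩
  · rintro z ⟨μp, μm, μ, hdual⟩
    linarith [reward_add_sum_mul_le_of_dualConstraint hp hdual]

theorem bonusOf_add_le (hD : D.confidenceSet.Nonempty) (h : Fin H) (x : S) (a : A) {β' : S → ℝ}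
    {B : ℝ} (hB : ∀ y, β' y ≤ B) :
    D.bonusOf M h x a β' + ∑ y, D.ref h x a y * β' y ≤ B := by
  obtain ⟨p, hp⟩ := hD
  rw [← le_sub_iff_add_le]
  refine csInf_le ⟨∑ y, p h x a y * β' y - ∑ y, D.ref h x a y * β' y, ?_⟩ ⟨0, 0, 0, ?_⟩
  · rintro z ⟨μp, μm, μ, hdual⟩
    linarith [reward_add_sum_mul_le_of_dualConstraint hp hdual]
  · rw [add_assoc, sub_add_cancel]
    exact dualConstraint_zero M D h x a hB

variable [Fintype A] [Nonempty A]

theorem optimisticValue_last (M : EpisodicMDP S A H) (D : ConfidenceData S A I H) (x : S) :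
    D.optimisticValue M (Fin.last H) x = 0 := by
  simp [optimisticValue]

theorem optimisticValue_castSucc (M : EpisodicMDP S A H) (D : ConfidenceData S A I H) (h : Fin H)
    (x : S) :
    D.optimisticValue M h.castSucc x = Finset.univ.sup' Finset.univ_nonempty fun a =>
      M.reward h x a + D.bonus M h x a + ∑ y, D.ref h x a y * D.optimisticValue M h.succ y := by
  simp [optimisticValue, bonus]

theorem stageValue_le_optimisticValue (hM : M.trans ∈ D.confidenceSet) (π : Fin H → S → A)
    (h : Fin (H + 1)) (x : S) : M.stageValue π h x ≤ D.optimisticValue M h x := by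
  induction h using Fin.reverseInduction generalizing x with
  | last => rw [M.stageValue_last, optimisticValue_last]
  | cast h ih =>
    calc M.stageValue π h.castSucc x
        = M.reward h x (π h x) + ∑ y, M.trans h x (π h x) y * M.stageValue π h.succ y :=
          M.stageValue_castSucc π h x
      _ ≤ M.reward h x (π h x) + ∑ y, M.trans h x (π h x) y * D.optimisticValue M h.succ y := by
          gcongr with y
          · exact (M.trans_mem _ _ _).1 y
          · exact ih y
      _ ≤ M.reward h x (π h x) + D.bonus M h x (π h x) +
            ∑ y, D.ref h x (π h x) y * D.optimisticValue M h.succ y := by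
          rw [add_assoc]
          gcongr
          exact sum_mul_le_bonusOf_add hM h x (π h x) _
      _ ≤ D.optimisticValue M h.castSucc x := by
          rw [optimisticValue_castSucc]
          exact Finset.le_sup' (fun a => M.reward h x a + D.bonus M h x a +
            ∑ y, D.ref h x a y * D.optimisticValue M h.succ y) (Finset.mem_univ (π h x))

theorem optimisticValue_le (hD : D.confidenceSet.Nonempty) (h : Fin (H + 1)) (x : S) :
    D.optimisticValue M h x ≤ H - (h : ℕ) := by
  induction h using Fin.reverseInduction generalizing x with
  | last => simp [optimisticValue_last]
  | cast h ih =>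
    rw [optimisticValue_castSucc]
    refine Finset.sup'_le _ _ fun a _ => ?_
    have hbonus : D.bonus M h x a + ∑ y, D.ref h x a y * D.optimisticValue M h.succ y ≤
        H - ((h : ℕ) + 1) := bonusOf_add_le hD h x a fun y => by simpa using ih y
    have hreward := (M.reward_mem h x a).2
    rw [Fin.val_castSucc]
    linarith

theorem optValue_le_optimisticValue (hM : M.trans ∈ D.confidenceSet) (x : S) :
    M.optValue x ≤ D.optimisticValue M 0 x :=
  ciSup_le fun π => (M.value_eq_stageValue_zero π x).trans_le
    (stageValue_le_optimisticValue hM π 0 x)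

end ConfidenceData

/-! ### Decomposition of the excess of the optimistic value -/

theorem sum_castSucc_sub_succ {G : Type*} [AddCommGroup G] {n : ℕ} (f : Fin (n + 1) → G) :
    ∑ h : Fin n, (f h.castSucc - f h.succ) = f 0 - f (Fin.last n) := by
  rw [Finset.sum_sub_distrib, sub_eq_sub_iff_add_eq_add, ← Fin.sum_univ_castSucc,
    Fin.sum_univ_succ]

namespace ConfidenceData

variable {S A I : Type*} [Fintype S] [Fintype I] [Fintype A] [Nonempty A] {H : ℕ}
  {M : EpisodicMDP S A H} {D : ConfidenceData S A I H}

/-- The excess of the optimistic value over the value of a policy, clamped to `[0, H]`. On the event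
that the confidence set contains the true transitions the clamping has no effect
(`clampedExcess_eq`); it makes the martingale differences of the regret bounded everywhere. -/
def clampedExcess (M : EpisodicMDP S A H) (D : ConfidenceData S A I H) (π : Fin H → S → A)
    (h : Fin (H + 1)) (x : S) : ℝ :=
  max 0 (min H (D.optimisticValue M h x - M.stageValue π h x))

theorem clampedExcess_mem_Icc (M : EpisodicMDP S A H) (D : ConfidenceData S A I H)
    (π : Fin H → S → A) (h : Fin (H + 1)) (x : S) : D.clampedExcess M π h x ∈ Set.Icc 0 (H : ℝ) :=
  ⟨le_max_left _ _, max_le (Nat.cast_nonneg _) (min_le_left _ _)⟩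

theorem clampedExcess_eq (hM : M.trans ∈ D.confidenceSet) (π : Fin H → S → A) (h : Fin (H + 1))
    (x : S) : D.clampedExcess M π h x = D.optimisticValue M h x - M.stageValue π h x := by
  have hle := stageValue_le_optimisticValue hM π h x
  have hupper := optimisticValue_le (M := M) ⟨_, hM⟩ h x
  have hnonneg := M.stageValue_nonneg π h x
  rw [clampedExcess, min_eq_right, max_eq_right] <;> linarith [Nat.cast_nonneg (α := ℝ) (h : ℕ)]

/-- The deviation of the clamped excess at the state following stage `h` of the trajectory `τ` from
its conditional mean given the state at stage `h`. -/
def excessNoise (M : EpisodicMDP S A H) (D : ConfidenceData S A I H) (π : Fin H → S → A)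
    (τ : Fin (H + 1) → S) (h : Fin H) : ℝ :=
  ∑ y, M.trans h (τ h.castSucc) (π h (τ h.castSucc)) y * D.clampedExcess M π h.succ y -
    D.clampedExcess M π h.succ (τ h.succ)

theorem excessNoise_mem_Icc (M : EpisodicMDP S A H) (D : ConfidenceData S A I H)
    (π : Fin H → S → A) (τ : Fin (H + 1) → S) (h : Fin H) :
    D.excessNoise M π τ h ∈ Set.Icc (-H : ℝ) H := by
  obtain ⟨hp0, hp1⟩ := M.trans_mem h (τ h.castSucc) (π h (τ h.castSucc))
  obtain ⟨hmean0, hmeanH⟩ := (convex_Icc 0 (H : ℝ)).sum_mem (fun y _ => hp0 y) hp1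
    fun y _ => D.clampedExcess_mem_Icc M π h.succ y
  obtain ⟨hnext0, hnextH⟩ := D.clampedExcess_mem_Icc M π h.succ (τ h.succ)
  simp only [smul_eq_mul] at hmean0 hmeanH
  rw [excessNoise]
  constructor <;> linarith

theorem optimisticValue_sub_stageValue_eq_sum (hM : M.trans ∈ D.confidenceSet)
    {π : Fin H → S → A} (hπ : D.IsOptimisticPolicy M π) (τ : Fin (H + 1) → S) :
    D.optimisticValue M 0 (τ 0) - M.stageValue π 0 (τ 0) =
      ∑ h : Fin H, (D.bonus M h (τ h.castSucc) (π h (τ h.castSucc)) +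
        D.transitionGap M h (τ h.castSucc) (π h (τ h.castSucc)) + D.excessNoise M π τ h) := by
  set excess : Fin (H + 1) → ℝ := fun h => D.optimisticValue M h (τ h) - M.stageValue π h (τ h)
  have hlast : excess (Fin.last H) = 0 := by
    simp [excess, optimisticValue_last, M.stageValue_last]
  have hstep (h : Fin H) : excess h.castSucc - excess h.succ =
      D.bonus M h (τ h.castSucc) (π h (τ h.castSucc)) +
        D.transitionGap M h (τ h.castSucc) (π h (τ h.castSucc)) + D.excessNoise M π τ h := by
    simp only [excess, hπ h (τ h.castSucc), M.stageValue_castSucc, transitionGap, excessNoise,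
      clampedExcess_eq hM, mul_sub, sub_mul, Finset.sum_sub_distrib]
    ring
  rw [← Finset.sum_congr rfl fun h _ => hstep h, sum_castSucc_sub_succ, hlast, sub_zero]

theorem optValue_sub_value_le (hM : M.trans ∈ D.confidenceSet) {π : Fin H → S → A}
    (hπ : D.IsOptimisticPolicy M π) (τ : Fin (H + 1) → S) :
    M.optValue (τ 0) - M.value π (τ 0) ≤
      ∑ h : Fin H, (D.bonus M h (τ h.castSucc) (π h (τ h.castSucc)) +
        D.transitionGap M h (τ h.castSucc) (π h (τ h.castSucc)) + D.excessNoise M π τ h) := by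
  rw [← optimisticValue_sub_stageValue_eq_sum hM hπ, M.value_eq_stageValue_zero]
  exact sub_le_sub_right (optValue_le_optimisticValue hM _) _

end ConfidenceData

/-! ### Measurability of the optimistic value -/

theorem toReal_sInf_coe_image (s : Set ℝ) :
    (sInf ((↑) '' s : Set EReal)).toReal = sInf s := by
  rcases s.eq_empty_or_nonempty with rfl | hne
  · simp
  by_cases hbdd : BddBelow s
  · rw [← Monotone.map_csInf_of_continuousAt continuous_coe_real_ereal.continuousAt
      EReal.coe_strictMono.monotone hne hbdd, EReal.toReal_coe]
  · have hbot : sInf ((↑) '' s : Set EReal) = ⊥ := by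
      refine sInf_eq_bot.2 fun b hb => ?_
      obtain ⟨c, -, hcb⟩ := EReal.lt_iff_exists_real_btwn.1 hb
      obtain ⟨z, hz, hzc⟩ := not_bddBelow_iff.1 hbdd c
      exact ⟨z, Set.mem_image_of_mem _ hz, (EReal.coe_lt_coe hzc).trans hcb⟩
    rw [hbot, EReal.toReal_bot, Real.sInf_of_not_bddBelow hbdd]

-- The infimum is taken in `EReal`, where it is meaningful for all sets; `EReal.toReal` then
-- reproduces the value `0` that `sInf` assigns to empty and to unbounded sets of reals.
theorem measurable_sInf_of_measurableSet_exists_le {Ω : Type*} {mΩ : MeasurableSpace Ω}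
    {F : Ω → Set ℝ} (hF : ∀ c, MeasurableSet {ω | ∃ z ∈ F ω, z ≤ c}) :
    Measurable fun ω => sInf (F ω) := by
  have hEReal : Measurable fun ω => sInf ((↑) '' F ω : Set EReal) := by
    refine measurable_of_Iio fun c => ?_
    have hset : (fun ω => sInf ((↑) '' F ω : Set EReal)) ⁻¹' Set.Iio c =
        ⋃ q : {q : ℚ // ((q : ℝ) : EReal) < c}, {ω | ∃ z ∈ F ω, z ≤ (q : ℚ)} := by
      ext ω
      simp only [Set.mem_preimage, Set.mem_Iio, sInf_lt_iff, Set.exists_mem_image, Set.mem_iUnion,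
        Set.mem_ofPred_eq]
      constructor
      · rintro ⟨z, hz, hzc⟩
        obtain ⟨q, hzq, hqc⟩ := EReal.lt_iff_exists_rat_btwn.1 hzc
        exact ⟨⟨q, hqc⟩, z, hz, (EReal.coe_lt_coe_iff.1 hzq).le⟩
      · rintro ⟨⟨q, hqc⟩, z, hz, hzq⟩
        exact ⟨z, hz, (EReal.coe_le_coe hzq).trans_lt hqc⟩
    rw [hset]
    exact MeasurableSet.iUnion fun q => hF q
  simpa only [toReal_sInf_coe_image] using hEReal.ereal_toReal

theorem measurableSet_exists_mem_of_isClosed {X Y : Type*} [TopologicalSpace X] [MeasurableSpace X]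
    [OpensMeasurableSpace X] [TopologicalSpace Y] [SigmaCompactSpace Y] {C : Set (X × Y)}
    (hC : IsClosed C) : MeasurableSet {θ | ∃ y, (θ, y) ∈ C} := by
  have hunion : {θ | ∃ y, (θ, y) ∈ C} =
      ⋃ n, Prod.fst '' {q : X × compactCovering Y n | (q.1, (q.2 : Y)) ∈ C} := by
    ext θ
    suffices (∃ y, (θ, y) ∈ C) ↔ ∃ n, ∃ y ∈ compactCovering Y n, (θ, y) ∈ C by simpa
    exact ⟨fun ⟨y, hy⟩ => ⟨_, y, (exists_mem_compactCovering y).choose_spec, hy⟩,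
      fun ⟨_, y, _, hy⟩ => ⟨y, hy⟩⟩
  rw [hunion]
  refine MeasurableSet.iUnion fun n => IsClosed.measurableSet ?_
  have : CompactSpace (compactCovering Y n) :=
    isCompact_iff_compactSpace.1 (isCompact_compactCovering Y n)
  exact isClosedMap_fst_of_compactSpace _ (hC.preimage (by fun_prop))

theorem measurable_sInf_of_isClosed {X Y : Type*} [TopologicalSpace X] [MeasurableSpace X]
    [OpensMeasurableSpace X] [TopologicalSpace Y] [SigmaCompactSpace Y] {C : Set (X × ℝ × Y)}
    (hC : IsClosed C) : Measurable fun θ => sInf {z : ℝ | ∃ y, (θ, z, y) ∈ C} := by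
  refine measurable_sInf_of_measurableSet_exists_le fun c => ?_
  have hCc : IsClosed (C ∩ {q | q.2.1 ≤ c}) := hC.inter (isClosed_le (by fun_prop) (by fun_prop))
  convert measurableSet_exists_mem_of_isClosed hCc using 1
  ext θ
  simp only [Set.mem_ofPred_eq, Set.mem_inter_iff, Prod.exists, exists_and_right]

namespace ConfidenceData

variable {S A I Ω : Type*} [Fintype S] [Fintype I] {H : ℕ} {mΩ : MeasurableSpace Ω}

theorem isClosed_dualConstraint {X : Type*} [TopologicalSpace X] (M : EpisodicMDP S A H)
    {D : X → ConfidenceData S A I H} {h : Fin H} {x : S} {a : A} {v : X → ℝ}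
    {β' μp μm : X → S → ℝ} {μ : X → I → ℝ} (href : Continuous fun q => (D q).ref h x a)
    (hweight : Continuous fun q => (D q).weight h)
    (hwidth : Continuous fun q i => (D q).width h i x a) (hv : Continuous v)
    (hβ' : Continuous β') (hμp : Continuous μp) (hμm : Continuous μm) (hμ : Continuous μ) :
    IsClosed {q | (D q).DualConstraint M h x a (v q) (β' q) (μp q) (μm q) (μ q)} := by
  have hwidth_apply (i : I) : Continuous fun q => (D q).width h i x a :=
    (continuous_apply i).comp hwidth
  simp only [DualConstraint, Set.ofPred_and, Set.ofPred_forall]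
  refine .inter ?_ <| .inter ?_ <| .inter ?_ <| .inter ?_ ?_ <;>
    exact isClosed_iInter fun _ => isClosed_le (by fun_prop) (by fun_prop)

theorem measurable_bonusOf (M : EpisodicMDP S A H) {D : Ω → ConfidenceData S A I H} {h : Fin H}
    {x : S} {a : A} {β' : Ω → S → ℝ} (href : ∀ y, Measurable fun ω => (D ω).ref h x a y)
    (hweight : ∀ i y, Measurable fun ω => (D ω).weight h i y)
    (hwidth : ∀ i, Measurable fun ω => (D ω).width h i x a)
    (hβ' : ∀ y, Measurable fun ω => β' ω y) :
    Measurable fun ω => (D ω).bonusOf M h x a (β' ω) := by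
  let data (θ : (S → ℝ) × (I → S → ℝ) × (I → ℝ) × (S → ℝ)) : ConfidenceData S A I H :=
    ⟨fun _ _ _ => θ.1, fun _ => θ.2.1, fun _ i _ _ => θ.2.2.1 i⟩
  have hclosed : IsClosed {q : ((S → ℝ) × (I → S → ℝ) × (I → ℝ) × (S → ℝ)) × ℝ × (S → ℝ) ×
      (S → ℝ) × (I → ℝ) | (data q.1).DualConstraint M h x a
        (M.reward h x a + q.2.1 + ∑ y, q.1.1 y * q.1.2.2.2 y) q.1.2.2.2 q.2.2.1 q.2.2.2.1
        q.2.2.2.2} := by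
    refine isClosed_dualConstraint M continuous_fst.fst continuous_fst.snd.fst
      continuous_fst.snd.snd.fst ?_ ?_ ?_ ?_ ?_ <;> fun_prop
  have hparam : Measurable fun ω =>
      ((D ω).ref h x a, (D ω).weight h, (fun i => (D ω).width h i x a), β' ω) := by
    fun_prop
  convert (measurable_sInf_of_isClosed hclosed).comp hparam using 2 with ω
  simp only [bonusOf, DualConstraint, Function.comp, data, Set.mem_ofPred_eq, Prod.exists]

theorem measurable_optimisticValue [Fintype A] [Nonempty A] (M : EpisodicMDP S A H)
    {D : Ω → ConfidenceData S A I H} (href : ∀ h x a y, Measurable fun ω => (D ω).ref h x a y)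
    (hweight : ∀ h i y, Measurable fun ω => (D ω).weight h i y)
    (hwidth : ∀ h i x a, Measurable fun ω => (D ω).width h i x a) (h : Fin (H + 1)) (x : S) :
    Measurable fun ω => (D ω).optimisticValue M h x := by
  induction h using Fin.reverseInduction generalizing x with
  | last => simp only [optimisticValue_last, measurable_const]
  | cast h ih =>
    have hbonus (a : A) : Measurable fun ω => (D ω).bonus M h x a :=
      measurable_bonusOf M (href h x a) (hweight h) (fun i => hwidth h i x a) ih
    convert Finset.measurable_sup' (Finset.univ_nonempty (α := A)) (f := fun a ω =>
      M.reward h x a + (D ω).bonus M h x a +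
        ∑ y, (D ω).ref h x a y * (D ω).optimisticValue M h.succ y) fun a _ => by fun_prop using 2
      with ω
    rw [optimisticValue_castSucc, Finset.sup'_apply]

end ConfidenceData

/-! ### The Azuma–Hoeffding inequality -/

section AzumaHoeffding

open ProbabilityTheory

variable {Ω : Type*} {m mΩ : MeasurableSpace Ω} {μ : Measure Ω} {X Y : Ω → ℝ} {a b : ℝ}

theorem integral_mul_eq_zero_of_condExp_eq_zero (hm : m ≤ mΩ) [SigmaFinite (μ.trim hm)]
    (hX : StronglyMeasurable[m] X) (hXY : Integrable (fun ω => X ω * Y ω) μ) (hY : Integrable Y μ)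
    (hcond : μ[Y | m] =ᵐ[μ] 0) : ∫ ω, X ω * Y ω ∂μ = 0 := by
  have hpull : μ[fun ω => X ω * Y ω | m] =ᵐ[μ] fun ω => X ω * μ[Y | m] ω :=
    condExp_mul_of_stronglyMeasurable_left hX hXY hY
  rw [← integral_condExp hm, integral_congr_ae hpull]
  refine integral_eq_zero_of_ae ?_
  filter_upwards [hcond] with ω hω
  rw [hω, Pi.zero_apply, mul_zero]

theorem hasSubgaussianMGF_tilted_of_condExp_eq_zero [IsProbabilityMeasure μ] (hm : m ≤ mΩ)
    (hX : Measurable[m] X) (hexp : Integrable (fun ω => Real.exp (X ω)) μ)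
    (hY : AEMeasurable Y μ) (hab : ∀ᵐ ω ∂μ, Y ω ∈ Set.Icc a b) (hcond : μ[Y | m] =ᵐ[μ] 0) :
    HasSubgaussianMGF Y ((‖b - a‖₊ / 2) ^ 2) (μ.tilted X) := by
  have hac := tilted_absolutelyContinuous μ X
  have hYint := Integrable.of_mem_Icc a b hY hab
  have := isProbabilityMeasure_tilted hexp
  refine hasSubgaussianMGF_of_mem_Icc_of_integral_eq_zero (hY.mono_ac hac) (hac hab) ?_
  have hdensity : StronglyMeasurable[m] fun ω => Real.exp (X ω) / ∫ ω, Real.exp (X ω) ∂μ :=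
    ((Real.measurable_exp.comp hX).div_const _).stronglyMeasurable
  have hint : Integrable (fun ω => Real.exp (X ω) / (∫ ω, Real.exp (X ω) ∂μ) * Y ω) μ :=
    (hexp.div_const _).mul_bdd hY.aestronglyMeasurable
      (hab.mono fun ω hω => abs_le_max_abs_abs hω.1 hω.2)
  rw [integral_tilted]
  exact integral_mul_eq_zero_of_condExp_eq_zero hm hdensity hint hYint hcond

-- Mathlib's Azuma–Hoeffding inequality conditions on a kernel and hence needs a standard Borel `Ω`.
-- Instead, `Y` is still centred, and therefore sub-Gaussian by Hoeffding's lemma, under the measure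
-- tilted by the past, and tilting turns the moment generating function of a sum into a product.
theorem hasSubgaussianMGF_add_of_condExp_eq_zero [IsProbabilityMeasure μ] (hm : m ≤ mΩ)
    (hX : Measurable[m] X) {c : NNReal} (hXc : HasSubgaussianMGF X c μ)
    (hY : AEMeasurable Y μ) (hab : ∀ᵐ ω ∂μ, Y ω ∈ Set.Icc a b) (hcond : μ[Y | m] =ᵐ[μ] 0) :
    HasSubgaussianMGF (fun ω => X ω + Y ω) (c + (‖b - a‖₊ / 2) ^ 2) μ := by
  have htilted (t : ℝ) := hasSubgaussianMGF_tilted_of_condExp_eq_zero hm (hX.const_mul t)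
    (hXc.integrable_exp_mul t) hY hab hcond
  refine ⟨fun t => ?_, fun t => ?_⟩
  · simpa only [smul_eq_mul, ← Real.exp_add, ← mul_add] using
      (integrable_tilted_iff (hXc.integrable_exp_mul t) _).1 ((htilted t).integrable_exp_mul t)
  · have hmgf : mgf (fun ω => X ω + Y ω) μ t = mgf X μ t * mgf Y (μ.tilted (t * X ·)) t := by
      simp only [mgf, integral_exp_tilted, Pi.add_apply, mul_add]
      rw [mul_div_cancel₀ _ (integral_exp_pos (hXc.integrable_exp_mul t)).ne']
    calc mgf (fun ω => X ω + Y ω) μ t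
        = mgf X μ t * mgf Y (μ.tilted (t * X ·)) t := hmgf
      _ ≤ Real.exp (c * t ^ 2 / 2) *
            Real.exp (((‖b - a‖₊ / 2) ^ 2 : NNReal) * t ^ 2 / 2) := by
          gcongr
          · exact mgf_nonneg
          · exact hXc.mgf_le t
          · exact (htilted t).mgf_le t
      _ = Real.exp ((c + (‖b - a‖₊ / 2) ^ 2 : NNReal) * t ^ 2 / 2) := by
          rw [← Real.exp_add, NNReal.coe_add, add_mul, add_div]

theorem hasSubgaussianMGF_sum_of_condExp_eq_zero [IsProbabilityMeasure μ] {ι : Type*}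
    [LinearOrder ι] {m : ι → MeasurableSpace Ω} (hm : ∀ i, m i ≤ mΩ) {Y : ι → Ω → ℝ}
    (hY : ∀ i, AEMeasurable (Y i) μ) (hpast : ∀ i j, i < j → Measurable[m j] (Y i))
    (hab : ∀ i, ∀ᵐ ω ∂μ, Y i ω ∈ Set.Icc a b) (hcond : ∀ i, μ[Y i | m i] =ᵐ[μ] 0) (s : Finset ι) :
    HasSubgaussianMGF (fun ω => ∑ i ∈ s, Y i ω) (s.card * (‖b - a‖₊ / 2) ^ 2) μ := by
  induction s using Finset.induction_on_max with
  | empty => simp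
  | insert j s hlt ih =>
    have hj : j ∉ s := fun hmem => (hlt j hmem).false
    have hsum : Measurable[m j] fun ω => ∑ i ∈ s, Y i ω :=
      Finset.measurable_fun_sum s fun i hi => hpast i j (hlt i hi)
    convert hasSubgaussianMGF_add_of_condExp_eq_zero (hm j) hsum ih (hY j) (hab j) (hcond j) using 1
    · ext ω
      rw [Finset.sum_insert hj, add_comm]
    · rw [Finset.card_insert_of_notMem hj, Nat.cast_succ, add_one_mul]

theorem measureReal_sqrt_lt_le_of_hasSubgaussianMGF [IsFiniteMeasure μ] {c : NNReal}
    (hX : HasSubgaussianMGF X c μ) {δ : ℝ} (hδ : 0 < δ) (hδ1 : δ ≤ 1) :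
    μ.real {ω | √(2 * c * Real.log (1 / δ)) < X ω} ≤ δ := by
  have hlog : 0 ≤ Real.log (1 / δ) := Real.log_nonneg (one_le_one_div hδ hδ1)
  rcases eq_or_ne c 0 with rfl | hc
  · have hzero : ∀ᵐ ω ∂μ, ω ∉ {ω | √(2 * (0 : NNReal) * Real.log (1 / δ)) < X ω} := by
      filter_upwards [hX.ae_eq_zero_of_hasSubgaussianMGF_zero] with ω hω
      simp [hω]
    rw [measureReal_def, measure_eq_zero_iff_ae_notMem.2 hzero, ENNReal.toReal_zero]
    exact hδ.le
  · calc μ.real {ω | √(2 * c * Real.log (1 / δ)) < X ω}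
        ≤ μ.real {ω | √(2 * c * Real.log (1 / δ)) ≤ X ω} :=
          measureReal_mono fun ω (hω : _ < X ω) => hω.le
      _ ≤ Real.exp (-√(2 * c * Real.log (1 / δ)) ^ 2 / (2 * c)) :=
          hX.measure_ge_le (Real.sqrt_nonneg _)
      _ = δ := by
          have hc' : (2 * c : ℝ) ≠ 0 := by positivity
          rw [Real.sq_sqrt (by positivity), neg_div, mul_div_cancel_left₀ _ hc', one_div,
            Real.log_inv, neg_neg, Real.exp_log hδ]

end AzumaHoeffding

/-! ### The martingale differences of an episodic interaction -/

theorem measurable_apply_of_countable {Ω β γ : Type*} [Countable β] {mΩ : MeasurableSpace Ω}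
    [MeasurableSpace γ] {g : Ω → β} (hg : ∀ b, MeasurableSet (g ⁻¹' {b})) {f : β → Ω → γ}
    (hf : ∀ b, Measurable (f b)) : Measurable fun ω => f (g ω) ω := by
  let : MeasurableSpace β := ⊤
  exact (measurable_from_prod_countable_right (f := fun q : β × Ω => f q.1 q.2) hf).comp
    ((measurable_to_countable' hg).prodMk measurable_id)

theorem condExp_apply_ae_eq_sum {Ω S : Type*} [Fintype S] {m mΩ : MeasurableSpace Ω}
    {μ : Measure Ω} [IsFiniteMeasure μ] {X : Ω → S} (hX : ∀ y, MeasurableSet (X ⁻¹' {y}))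
    {p : S → Ω → ℝ} (hp : ∀ y, μ[(X ⁻¹' {y}).indicator (fun _ => (1 : ℝ)) | m] =ᵐ[μ] p y)
    {f : S → Ω → ℝ} (hf : ∀ y, StronglyMeasurable[m] (f y)) (hfint : ∀ y, Integrable (f y) μ) :
    μ[fun ω => f (X ω) ω | m] =ᵐ[μ] fun ω => ∑ y, p y ω * f y ω := by
  classical
  set J : S → Ω → ℝ := fun y => (X ⁻¹' {y}).indicator fun _ => 1
  have hJ (y : S) : Integrable (J y) μ := (integrable_const 1).indicator (hX y)
  have hfJ (y : S) : Integrable (f y * J y) μ := by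
    have hindicator : f y * J y = (X ⁻¹' {y}).indicator (f y) := by
      ext ω
      simp [J, Set.indicator_apply]
    rw [hindicator]
    exact (hfint y).indicator (hX y)
  have hsplit : (fun ω => f (X ω) ω) = ∑ y, f y * J y := by
    ext ω
    simp [J, Set.indicator_apply]
  have hpull (y : S) : μ[f y * J y | m] =ᵐ[μ] p y * f y := by
    rw [mul_comm (p y)]
    exact (condExp_mul_of_stronglyMeasurable_left (hf y) (hfJ y) (hJ y)).trans
      ((hp y).mono fun ω hω => by simp only [Pi.mul_apply, J, hω])
  rw [hsplit]
  filter_upwards [condExp_finsetSum (fun y (_ : y ∈ Finset.univ) => hfJ y) m,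
    Filter.eventually_all.2 hpull] with ω hsum hterm
  simp only [hsum, Finset.sum_apply, hterm, Pi.mul_apply]

namespace IsEpisodicInteraction

variable {S A I Ω : Type*} [Fintype S] {H K : ℕ} {mΩ : MeasurableSpace Ω} {M : EpisodicMDP S A H}
  {μ : Measure Ω} {𝓕 : Filtration ℕ mΩ} {x : Fin K → Fin (H + 1) → Ω → S}
  {π : Fin K → Ω → Fin H → S → A} {D : Fin K → Ω → ConfidenceData S A I H}

theorem measurableSet_policy_preimage (hrun : IsEpisodicInteraction M μ 𝓕 x π) (t : Fin K)
    (p : Fin H → S → A) : MeasurableSet[𝓕 (t * (H + 1))] (π t ⁻¹' {p}) := by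
  have : π t ⁻¹' {p} = ⋂ h, ⋂ y, {ω | π t ω h y = p h y} := by
    ext ω
    simp [funext_iff]
  rw [this]
  exact MeasurableSet.iInter fun h => MeasurableSet.iInter fun y =>
    hrun.measurable_policy t h y (p h y)

theorem measurable_trans [Finite A] (hrun : IsEpisodicInteraction M μ 𝓕 x π) (t : Fin K)
    (h : Fin H) (y : S) :
    Measurable[𝓕 (t * (H + 1) + h + 1)] fun ω =>
      M.trans h (x t h.castSucc ω) (π t ω h (x t h.castSucc ω)) y :=
  measurable_apply_of_countable (f := fun s ω => M.trans h s (π t ω h s) y)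
    (hrun.measurable_state t h.castSucc) fun s =>
      measurable_apply_of_countable (f := fun p _ => M.trans h s (p h s) y)
        (fun p => 𝓕.mono (by omega) _ (hrun.measurableSet_policy_preimage t p)) fun _ =>
          measurable_const

variable [Fintype A] [Nonempty A] [Fintype I]

theorem measurable_clampedExcess (hrun : IsEpisodicInteraction M μ 𝓕 x π)
    (hD : IsPredictableConfidence 𝓕 D) (t : Fin K) (h : Fin (H + 1)) (y : S) :
    Measurable[𝓕 (t * (H + 1))] fun ω => (D t ω).clampedExcess M (π t ω) h y := by
  refine measurable_apply_of_countable (f := fun p ω => (D t ω).clampedExcess M p h y)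
    (hrun.measurableSet_policy_preimage t) fun p => ?_
  have hvalue := ConfidenceData.measurable_optimisticValue M (hD.measurable_ref t)
    (hD.measurable_weight t) (hD.measurable_width t) h y
  exact measurable_const.max (measurable_const.min (hvalue.sub_const _))

theorem measurable_sum_trans_mul_clampedExcess (hrun : IsEpisodicInteraction M μ 𝓕 x π)
    (hD : IsPredictableConfidence 𝓕 D) (t : Fin K) (h : Fin H) :
    Measurable[𝓕 (t * (H + 1) + h + 1)] fun ω =>
      ∑ y, M.trans h (x t h.castSucc ω) (π t ω h (x t h.castSucc ω)) y *
        (D t ω).clampedExcess M (π t ω) h.succ y :=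
  Finset.measurable_fun_sum _ fun y _ => (hrun.measurable_trans t h y).mul
    ((hrun.measurable_clampedExcess hD t h.succ y).mono (𝓕.mono (by omega)) le_rfl)

theorem measurable_clampedExcess_state (hrun : IsEpisodicInteraction M μ 𝓕 x π)
    (hD : IsPredictableConfidence 𝓕 D) (t : Fin K) (h : Fin (H + 1)) :
    Measurable[𝓕 (t * (H + 1) + h + 1)] fun ω => (D t ω).clampedExcess M (π t ω) h (x t h ω) :=
  measurable_apply_of_countable (f := fun y ω => (D t ω).clampedExcess M (π t ω) h y)
    (hrun.measurable_state t h) fun y =>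
      (hrun.measurable_clampedExcess hD t h y).mono (𝓕.mono (by omega)) le_rfl

theorem measurable_excessNoise (hrun : IsEpisodicInteraction M μ 𝓕 x π)
    (hD : IsPredictableConfidence 𝓕 D) (t : Fin K) (h : Fin H) :
    Measurable[𝓕 (t * (H + 1) + h + 2)] fun ω =>
      (D t ω).excessNoise M (π t ω) (x t · ω) h :=
  ((hrun.measurable_sum_trans_mul_clampedExcess hD t h).mono (𝓕.mono (by omega)) le_rfl).sub
    (hrun.measurable_clampedExcess_state hD t h.succ)

theorem condExp_excessNoise [IsFiniteMeasure μ] (hrun : IsEpisodicInteraction M μ 𝓕 x π)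
    (hD : IsPredictableConfidence 𝓕 D) (t : Fin K) (h : Fin H) :
    μ[fun ω => (D t ω).excessNoise M (π t ω) (x t · ω) h | 𝓕 (t * (H + 1) + h + 1)] =ᵐ[μ] 0 := by
  have hexcess (y : S) := hrun.measurable_clampedExcess hD t h.succ y
  have hnext := (hrun.measurable_clampedExcess_state hD t h.succ).mono (𝓕.le _) le_rfl
  have hmean := hrun.measurable_sum_trans_mul_clampedExcess hD t h
  have hexcess_int (y : S) : Integrable (fun ω => (D t ω).clampedExcess M (π t ω) h.succ y) μ :=
    .of_mem_Icc 0 H ((hexcess y).mono (𝓕.le _) le_rfl).aemeasurable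
      (.of_forall fun ω => ConfidenceData.clampedExcess_mem_Icc ..)
  have hnext_int : Integrable
      (fun ω => (D t ω).clampedExcess M (π t ω) h.succ (x t h.succ ω)) μ :=
    .of_mem_Icc 0 H hnext.aemeasurable
      (.of_forall fun ω => ConfidenceData.clampedExcess_mem_Icc ..)
  have hcond := condExp_apply_ae_eq_sum (fun y => 𝓕.le _ _ (hrun.measurable_state t h.succ y))
    (hrun.transition_law t h) (fun y => ((hexcess y).mono (𝓕.mono (by omega))
      le_rfl).stronglyMeasurable) hexcess_int
  have hmean_int := integrable_condExp.congr hcond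
  filter_upwards [condExp_sub hmean_int hnext_int (𝓕 (t * (H + 1) + h + 1)), hcond]
    with ω hsub hω
  rw [condExp_of_stronglyMeasurable (𝓕.le _) hmean.stronglyMeasurable hmean_int, Pi.sub_apply, hω,
    sub_self] at hsub
  exact hsub

variable [IsProbabilityMeasure μ]

theorem hasSubgaussianMGF_sum_excessNoise (hrun : IsEpisodicInteraction M μ 𝓕 x π)
    (hD : IsPredictableConfidence 𝓕 D) :
    ProbabilityTheory.HasSubgaussianMGF
      (fun ω => ∑ t, ∑ h, (D t ω).excessNoise M (π t ω) (x t · ω) h) (K * H * H ^ 2) μ := by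
  have hpast (i j : Fin K ×ₗ Fin H) (hij : i < j) :
      Measurable[𝓕 ((ofLex j).1 * (H + 1) + (ofLex j).2 + 1)] fun ω =>
        (D (ofLex i).1 ω).excessNoise M (π (ofLex i).1 ω) (x (ofLex i).1 · ω) (ofLex i).2 := by
    refine (hrun.measurable_excessNoise hD _ _).mono (𝓕.mono ?_) le_rfl
    rcases Prod.Lex.lt_iff.1 hij with hepisode | ⟨hepisode, hstage⟩
    · have := Nat.mul_le_mul_right (H + 1) (Nat.succ_le_of_lt (Fin.lt_def.1 hepisode))
      have := (ofLex i).2.isLt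
      lia
    · rw [hepisode]
      have := Fin.lt_def.1 hstage
      lia
  have hsum := hasSubgaussianMGF_sum_of_condExp_eq_zero (fun _ => 𝓕.le _)
    (fun i => ((hrun.measurable_excessNoise hD _ _).mono (𝓕.le _) le_rfl).aemeasurable) hpast
    (fun i => .of_forall fun ω => ConfidenceData.excessNoise_mem_Icc ..)
    (fun i => hrun.condExp_excessNoise hD _ _) Finset.univ
  convert hsum using 1
  · ext ω
    exact (Fintype.sum_prod_type' _).symm
  · have hnorm : ‖(H : ℝ) - -H‖₊ = 2 * H := by
      ext
      simp [← two_mul]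
    rw [hnorm, mul_div_cancel_left₀ _ two_ne_zero]
    simp

theorem exists_sum_excessNoise_le (hrun : IsEpisodicInteraction M μ 𝓕 x π)
    (hD : IsPredictableConfidence 𝓕 D) {δ : ℝ} (hδ : 0 < δ) (hδ1 : δ ≤ 1) :
    ∃ G : Set Ω, MeasurableSet G ∧ 1 - δ ≤ μ.real G ∧ ∀ ω ∈ G,
      ∑ t, ∑ h, (D t ω).excessNoise M (π t ω) (x t · ω) h ≤
        H * √(2 * (K * H : ℕ) * Real.log (1 / δ)) := by
  have hmeas : Measurable fun ω => ∑ t, ∑ h, (D t ω).excessNoise M (π t ω) (x t · ω) h :=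
    Finset.measurable_fun_sum _ fun t _ => Finset.measurable_fun_sum _ fun h _ =>
      (hrun.measurable_excessNoise hD t h).mono (𝓕.le _) le_rfl
  have htail := measureReal_sqrt_lt_le_of_hasSubgaussianMGF
    (hrun.hasSubgaussianMGF_sum_excessNoise hD) hδ hδ1
  have hbound : √(2 * (K * H * H ^ 2 : NNReal) * Real.log (1 / δ)) =
      H * √(2 * (K * H : ℕ) * Real.log (1 / δ)) := by
    rw [← Real.sqrt_sq (Nat.cast_nonneg H), ← Real.sqrt_mul (sq_nonneg _)]
    push_cast
    ring_nf
  rw [hbound] at htail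
  set E := {ω | H * √(2 * (K * H : ℕ) * Real.log (1 / δ)) <
    ∑ t, ∑ h, (D t ω).excessNoise M (π t ω) (x t · ω) h}
  have hE : MeasurableSet E := measurableSet_lt measurable_const hmeas
  refine ⟨Eᶜ, hE.compl, ?_, fun ω hω => not_lt.1 hω⟩
  rw [probReal_compl_eq_one_sub hE]
  exact sub_le_sub_left htail 1

end IsEpisodicInteraction

theorem regret_le_sum_bonus_add_sum_transitionGap_add_sum_excessNoise {S A I Ω : Type*} [Fintype S]
    [Fintype A] [Nonempty A] [Fintype I] {H K : ℕ} {M : EpisodicMDP S A H}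
    {x : Fin K → Fin (H + 1) → Ω → S} {π : Fin K → Ω → Fin H → S → A}
    {D : Fin K → Ω → ConfidenceData S A I H} {ω : Ω}
    (hM : ∀ t, M.trans ∈ (D t ω).confidenceSet)
    (hπ : ∀ t, (D t ω).IsOptimisticPolicy M (π t ω)) :
    regret M x π ω ≤
      (∑ t, ∑ h : Fin H,
        (D t ω).bonus M h (x t h.castSucc ω) (π t ω h (x t h.castSucc ω)))
      + (∑ t, ∑ h : Fin H,
        (D t ω).transitionGap M h (x t h.castSucc ω) (π t ω h (x t h.castSucc ω)))
      + ∑ t, ∑ h, (D t ω).excessNoise M (π t ω) (x t · ω) h := by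
  simp only [← Finset.sum_add_distrib]
  exact Finset.sum_le_sum fun t _ => ConfidenceData.optValue_sub_value_le (hM t) (hπ t) (x t · ω)

end

theorem mainTheorem3_general {S A I Ω : Type*} [Fintype S] [Fintype A] [Nonempty A] [Fintype I]
    {mΩ : MeasurableSpace Ω} (μ : MeasureTheory.Measure Ω) [MeasureTheory.IsProbabilityMeasure μ]
    (H K : ℕ) (M : EpisodicMDP S A H)
    (𝓕 : MeasureTheory.Filtration ℕ mΩ)
    (x : Fin K → Fin (H + 1) → Ω → S) (π : Fin K → Ω → Fin H → S → A)
    (D : Fin K → Ω → ConfidenceData S A I H)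
    (hrun : IsEpisodicInteraction M μ 𝓕 x π)
    (hD : IsPredictableConfidence 𝓕 D)
    (hπ : ∀ t ω, (D t ω).confidenceSet.Nonempty → (D t ω).IsOptimisticPolicy M (π t ω))
    (δ : ℝ) (hδ : 0 < δ) (hδ1 : δ ≤ 1) :
    ∃ G : Set Ω, MeasurableSet G ∧ 1 - δ ≤ μ.real G ∧
      ∀ ω ∈ G, (∀ t, M.trans ∈ (D t ω).confidenceSet) →
        regret M x π ω ≤
          (∑ t, ∑ h : Fin H,
            (D t ω).bonus M h (x t h.castSucc ω) (π t ω h (x t h.castSucc ω)))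
          + (∑ t, ∑ h : Fin H,
            (D t ω).transitionGap M h (x t h.castSucc ω) (π t ω h (x t h.castSucc ω)))
          + H * Real.sqrt (2 * (K * H : ℕ) * Real.log (1 / δ)) := by
  obtain ⟨G, hG, hprob, hnoise⟩ := hrun.exists_sum_excessNoise_le hD hδ hδ1
  refine ⟨G, hG, hprob, fun ω hω hM => ?_⟩
  have hregret := regret_le_sum_bonus_add_sum_transitionGap_add_sum_excessNoise (x := x) hM
    fun t => hπ t ω ⟨_, hM t⟩
  exact hregret.trans (add_le_add_right (hnoise ω hω) _)

theorem mainTheorem3 {S A I Ω : Type*} [Fintype S] [Fintype A] [Nonempty A] [Fintype I]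
    {mΩ : MeasurableSpace Ω} (μ : MeasureTheory.Measure Ω) [MeasureTheory.IsProbabilityMeasure μ]
    (H K : ℕ) (M : EpisodicMDP S A H)
    (𝓕 : MeasureTheory.Filtration ℕ mΩ)
    (x : Fin K → Fin (H + 1) → Ω → S) (π : Fin K → Ω → Fin H → S → A)
    (D : Fin K → Ω → ConfidenceData S A I H)
    (hrun : IsEpisodicInteraction M μ 𝓕 x π)
    (hD : IsPredictableConfidence 𝓕 D)
    (hπ : ∀ t ω, (D t ω).confidenceSet.Nonempty → (D t ω).IsOptimisticPolicy M (π t ω))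
    (δ : ℝ) (hδ : 0 < δ) (hδ1 : δ ≤ 1) :
    ∃ G : Set Ω, MeasurableSet G ∧ 1 - 2 * δ ≤ μ.real G ∧
      ∀ ω ∈ G, (∀ t, M.trans ∈ (D t ω).confidenceSet) →
        regret M x π ω ≤
          (∑ t, ∑ h : Fin H,
            (D t ω).bonus M h (x t h.castSucc ω) (π t ω h (x t h.castSucc ω)))
          + (∑ t, ∑ h : Fin H,
            (D t ω).transitionGap M h (x t h.castSucc ω) (π t ω h (x t h.castSucc ω)))
          + 2 * H * Real.sqrt (2 * (K * H : ℕ) * Real.log (1 / δ)) := by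
  obtain ⟨G, hG, hprob, hbound⟩ := mainTheorem3_general μ H K M 𝓕 x π D hrun hD hπ δ hδ hδ1
  refine ⟨G, hG, by linarith, fun ω hω hM => (hbound ω hω hM).trans ?_⟩
  gcongr
  exact le_mul_of_one_le_left (Nat.cast_nonneg H) one_le_two
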